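/- Let $\mathbb T$ be the unit circle with normalized arc length, $L_2=L_2(\mathbb T)$, and let $H_2\subset L_2$ be the subspace of functions whose negative Fourier coefficients vanish. A function $\varphi\in H_2$ is called inner if $|\varphi|=1$ almost everywhere on $\mathbb T$, and $\mathcal J=\{\varphi/\psi : \varphi,\psi \text{ inner}\}$ (functions on $\mathbb T$ are identified when they agree almost everywhere). Let $g=\sum_{\ell\ge 0}g_\ell z^\ell$ and $h=\sum_{\ell\ge 0}h_\ell z^\ell$ be nonzero functions in $H_2$, let $(w_k)_{k\in\mathbb Z}$ be white noise, i.e. complex square-integrable random variables on a probability space with $\mathbb E w_k=0$, $\mathbb E|w_k|^2=1$ and $\mathbb E\, w_k\overline{w_\ell}=0$ for $k\ne\ell$, and let $$x_k=\sum_{\ell=0}^\infty g_\ell w_{k-\ell},\qquad y_k=\sum_{\ell=0}^\infty h_\ell w_{k-\ell}\qquad(k\in\mathbb Z),$$ the series converging in mean square. Put $\xi_t=(x_t,y_t)^T$, and let $\hat\xi_t$ be the optimal linear estimate of $\xi_t$ from the future, i.e. each component of $\hat\xi_t$ is the orthogonal projection of the same component of $\xi_t$ onto the closed linear span of $\{x_k,y_k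 : k>t\}$. The process is called backward deterministic if the error variance matrix $\mathbb E\{(\xi_t-\hat\xi_t)(\xi_t-\hat\xi_t)^*\}$ is zero for every $t\in\mathbb Z$. Then the following three conditions are equivalent: (a) the process $(x_k,y_k)$ is backward deterministic; (b) the closed vector sum of the subspaces $\overline{\mathrm{span}}\{z^{-k}g : k\ge 0\}$ and $\overline{\mathrm{span}}\{z^{-k}h : k\ge 0\}$, i.e. the closure in $L_2$ of their sum, is equal to $L_2$; (c) $\dfrac{g\,\bar h}{\bar g\,h}\notin\mathcal J$. -/

import Mathlib

open MeasureTheory AddCircle ComplexConjugate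

noncomputable section

/-- The unit circle, parametrized by the angle `θ` modulo `2π`; the point with parameter `θ` is
`z = exp (i θ)`, so that `fourier n` is the function `z ^ n`. -/
abbrev UnitTorus : Type := AddCircle (2 * Real.pi)

instance fact_two_pi_pos : Fact (0 < 2 * Real.pi) := ⟨Real.two_pi_pos⟩

/-- The space `L₂` of the unit circle, with respect to normalized arc length. -/
abbrev L2Torus : Type := Lp ℂ 2 (haarAddCircle : Measure UnitTorus)

/-- Membership in the Hardy space `H₂`: all negative Fourier coefficients vanish. -/
def IsHardy (f : L2Torus) : Prop := ∀ n : ℤ, n < 0 → fourierCoeff (f : UnitTorus → ℂ) n = 0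

/-- Inner functions (through their boundary values): unimodular elements of `H₂`. -/
def IsInner (f : L2Torus) : Prop :=
  IsHardy f ∧ ∀ᵐ θ ∂(haarAddCircle : Measure UnitTorus), ‖f θ‖ = 1

/-- The functions on the circle that agree almost everywhere with a quotient of two inner
functions. -/
def innerQuotients : Set (UnitTorus → ℂ) :=
  {u | ∃ φ ψ : L2Torus, IsInner φ ∧ IsInner ψ ∧
    u =ᵐ[(haarAddCircle : Measure UnitTorus)] fun θ => φ θ / ψ θ}

theorem memLp_fourier_mul (n : ℤ) (f : L2Torus) :
    MemLp (fun θ => fourier n θ * f θ) 2 (haarAddCircle : Measure UnitTorus) := by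
  refine MemLp.of_le (Lp.memLp f) ?_ ?_
  · exact (fourier n).continuous.aestronglyMeasurable.mul (Lp.memLp f).1
  · refine Filter.Eventually.of_forall fun θ => ?_
    simp only [norm_mul, fourier_apply, Circle.norm_coe, one_mul, le_refl]

/-- The function `z ^ n * f` in `L₂`, for an integer `n`. -/
def zpowMul (n : ℤ) (f : L2Torus) : L2Torus := (memLp_fourier_mul n f).toLp _

/-- The closed linear span in `L₂` of the functions `z ^ (-k) * f`, `k ≥ 0`. -/
def closedSpanNegShifts (f : L2Torus) : Submodule ℂ L2Torus :=
  (Submodule.span ℂ (Set.range fun k : ℕ => zpowMul (-(k : ℤ)) f)).topologicalClosure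

/-- White noise: a sequence of square-integrable random variables with zero mean, unit variance
`E |w k| ^ 2 = 1`, and `E (w k * conj (w l)) = 0` for `k ≠ l`. -/
structure IsWhiteNoise {Ω : Type*} [MeasurableSpace Ω] (P : Measure Ω)
    (w : ℤ → Lp ℂ 2 P) : Prop where
  mean_zero : ∀ k, ∫ ω, w k ω ∂P = 0
  covariance : ∀ k l, ∫ ω, w k ω * conj (w l ω) ∂P = if k = l then 1 else 0

/-- `x` is the moving average `x k = ∑ ℓ ≥ 0, f ℓ * w (k - ℓ)`, convergent in mean square, where
the numbers `f ℓ` are the Taylor coefficients of `f = ∑ ℓ ≥ 0, f ℓ * z ^ ℓ`. -/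
def IsGeneratedBy {Ω : Type*} [MeasurableSpace Ω] {P : Measure Ω} (f : L2Torus)
    (w x : ℤ → Lp ℂ 2 P) : Prop :=
  ∀ k : ℤ, HasSum (fun ℓ : ℕ => fourierCoeff (f : UnitTorus → ℂ) (ℓ : ℤ) • w (k - (ℓ : ℤ))) (x k)

/-- The closed linear span of the components of the strict future `ξ k`, `k > t`. -/
def futureSpan {Ω : Type*} [MeasurableSpace Ω] {P : Measure Ω}
    (ξ : ℤ → Fin 2 → Lp ℂ 2 P) (t : ℤ) : Submodule ℂ (Lp ℂ 2 P) :=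
  (Submodule.span ℂ {v | ∃ k : ℤ, t < k ∧ ∃ i : Fin 2, v = ξ k i}).topologicalClosure

instance hasOrthogonalProjection_futureSpan {Ω : Type*} [MeasurableSpace Ω] {P : Measure Ω}
    (ξ : ℤ → Fin 2 → Lp ℂ 2 P) (t : ℤ) : (futureSpan ξ t).HasOrthogonalProjection := by
  unfold futureSpan
  infer_instance

/-- The error `ξ t - ξ̂ t` of the optimal linear estimate `ξ̂ t` of `ξ t` from the future: each
component of `ξ̂ t` is the orthogonal projection onto the closed span of the future. -/
def backwardError {Ω : Type*} [MeasurableSpace Ω] {P : Measure Ω}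
    (ξ : ℤ → Fin 2 → Lp ℂ 2 P) (t : ℤ) (i : Fin 2) : Lp ℂ 2 P :=
  ξ t i - (futureSpan ξ t).starProjection (ξ t i)

/-- The minimal backward error variance, the matrix
`E ((ξ t - ξ̂ t) * (ξ t - ξ̂ t)ᴴ)`. -/
def backwardErrorVariance {Ω : Type*} [MeasurableSpace Ω] {P : Measure Ω}
    (ξ : ℤ → Fin 2 → Lp ℂ 2 P) (t : ℤ) : Matrix (Fin 2) (Fin 2) ℂ :=
  Matrix.of fun i j => ∫ ω, backwardError ξ t i ω * conj (backwardError ξ t j ω) ∂P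

/-- A bivariate process is backward deterministic if it is predictable with zero error from its
future. -/
def IsBackwardDeterministic {Ω : Type*} [MeasurableSpace Ω] {P : Measure Ω}
    (ξ : ℤ → Fin 2 → Lp ℂ 2 P) : Prop :=
  ∀ t : ℤ, backwardErrorVariance ξ t = 0

end

/-!
Sending `z ^ n` to `w (-n)` is an isometry from `L₂` of the circle into the random variables, and it
carries `z ^ (-k) * g` and `z ^ (-k) * h` to `x k` and `y k`. Backward determinism therefore says that
the closed span `K t` of `z ^ (-k) * g`, `z ^ (-k) * h`, `k > t`, does not depend on `t`. In that case
a vector `f` orthogonal to `K t` is orthogonal to `z ^ k * g` for every integer `k`; all Fourier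
coefficients of `f * conj g` vanish, and `f = 0` because `g`, a nonzero function in `H₂`, is nonzero
almost everywhere (`IsHardy.ae_ne_zero`). So backward determinism is equivalent to density of the sum
of the two spans (`forall_mem_closure_futureShifts_iff`).

Density fails if and only if some `f ≠ 0` makes all integrals of `z ^ k * f * conj g` and
`z ^ k * f * conj h`, `k ≥ 0`, vanish. If the quotient in the last condition is `α / β` with inner
`α`, `β`, then `f = z * β * g / conj g` does (`exists_orthogonal_of_mem_innerQuotients`). Conversely,
write `g = φ₁ * o₁` and `h = φ₂ * o₂` with inner `φᵢ` and outer `oᵢ`. As the `oᵢ` are cyclic for the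
shift, `f * conj g / o₁` and `f * conj h / o₂` belong to `z * H₂`. Both have the modulus of `f`, so
their outer factors differ by an inner function, and the quotient is a quotient of inner functions
(`mem_innerQuotients_of_orthogonal`).

The inner-outer factorization (`IsHardy.exists_inner_mul_outer`) is obtained in `L₂` alone, by
Beurling's argument, with "outer" meaning "cyclic for the shift"; this is the only property of outer
functions that the argument needs.
-/

local notation "𝕞" => (haarAddCircle : Measure UnitTorus)

/-! ### Fourier coefficients of integrable functions -/

theorem norm_fourier_apply (n : ℤ) (θ : UnitTorus) : ‖fourier n θ‖ = 1 := by
  rw [fourier_apply, Circle.norm_coe]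

theorem MeasureTheory.MemLp.fourier_mul {f : UnitTorus → ℂ} (hf : MemLp f 2 𝕞) (n : ℤ) :
    MemLp (fun θ => fourier n θ * f θ) 2 𝕞 := by
  refine hf.of_le ((fourier n).continuous.aestronglyMeasurable.mul hf.1) (.of_forall fun θ => ?_)
  rw [norm_mul, norm_fourier_apply, one_mul]

theorem memLp_fourier (n : ℤ) : MemLp (fun θ : UnitTorus => fourier n θ) 2 𝕞 := by
  simpa using (memLp_const (1 : ℂ) (μ := 𝕞) (p := 2)).fourier_mul n

/-- Uniqueness of Fourier coefficients for integrable functions. -/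
theorem ae_eq_zero_of_integral_fourier_mul_eq_zero {F : UnitTorus → ℂ} (hF : Integrable F 𝕞)
    (h : ∀ n : ℤ, ∫ θ, fourier n θ * F θ ∂𝕞 = 0) : F =ᵐ[𝕞] 0 := by
  have hint : ∀ q : C(UnitTorus, ℂ), Integrable (fun θ => q θ * F θ) 𝕞 := fun q =>
    hF.bdd_mul q.continuous.aestronglyMeasurable (.of_forall fun θ => q.norm_coe_le_norm θ)
  let Λ : C(UnitTorus, ℂ) →L[ℂ] ℂ := LinearMap.mkContinuous
    { toFun := fun q => ∫ θ, q θ * F θ ∂𝕞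
      map_add' := fun p q => by
        rw [← integral_add (hint p) (hint q)]
        simp only [ContinuousMap.add_apply, add_mul]
      map_smul' := fun c q => by
        simp only [ContinuousMap.smul_apply, smul_eq_mul, mul_assoc, RingHom.id_apply]
        exact integral_const_mul c _ }
    (∫ θ, ‖F θ‖ ∂𝕞) fun q => by
      refine (norm_integral_le_integral_norm _).trans ?_
      rw [mul_comm _ ‖q‖, ← integral_const_mul]
      refine integral_mono (hint q).norm (hF.norm.const_mul _) fun θ => ?_
      simp only [norm_mul]
      gcongr
      exact q.norm_coe_le_norm θ
  -- trigonometric polynomials are uniformly dense in the continuous functions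
  have hΛ : ∀ q, Λ q = 0 := by
    have hle : (Submodule.span ℂ (Set.range (@fourier (2 * Real.pi)))).topologicalClosure
        ≤ LinearMap.ker Λ.toLinearMap := by
      refine Submodule.topologicalClosure_minimal _ ?_ Λ.isClosed_ker
      rw [Submodule.span_le]
      rintro _ ⟨n, rfl⟩
      exact h n
    intro q
    rw [span_fourier_closure_eq_top] at hle
    exact hle (Submodule.mem_top (x := q))
  -- the indicator of a closed set is a bounded pointwise limit of continuous functions
  refine ae_eq_zero_of_forall_setIntegral_isClosed_eq_zero hF fun s hs => ?_
  have hlim := tendsto_integral_of_dominated_convergence (μ := 𝕞) (fun θ => ‖F θ‖)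
    (F := fun n θ => (((hs.apprSeq n θ : NNReal) : ℝ) : ℂ) * F θ)
    (f := fun θ => s.indicator F θ) ?_ hF.norm ?_ ?_
  · rw [← integral_indicator hs.measurableSet]
    refine tendsto_nhds_unique hlim ?_
    refine tendsto_const_nhds.congr fun n => Eq.symm ?_
    exact hΛ ⟨fun θ => (((hs.apprSeq n θ : NNReal) : ℝ) : ℂ), by fun_prop⟩
  · intro n
    exact (Continuous.aestronglyMeasurable (by fun_prop)).mul hF.1
  · refine fun n => .of_forall fun θ => ?_
    rw [norm_mul]
    refine mul_le_of_le_one_left (norm_nonneg _) ?_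
    simpa using HasOuterApproxClosed.apprSeq_apply_le_one hs n θ
  · refine .of_forall fun θ => ?_
    have h1 := (tendsto_pi_nhds.1 (HasOuterApproxClosed.tendsto_apprSeq hs)) θ
    have h2 := ((Complex.continuous_ofReal.comp NNReal.continuous_coe).tendsto _).comp h1
    have h3 := h2.mul_const (F θ)
    have e : s.indicator F θ =
        (Complex.ofReal ∘ NNReal.toReal) (s.indicator (fun _ => 1) θ) * F θ := by
      by_cases hθ : θ ∈ s <;> simp [hθ]
    rw [e]
    exact h3

/-! ### Hardy and outer functions -/

/-- Membership in `H₂` for a function, rather than for a class in `L₂`: the function is square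
integrable, and its Fourier coefficients of index `-(n + 1)`, `n ≥ 0`, vanish. -/
structure IsHardyFun (f : UnitTorus → ℂ) : Prop where
  memLp : MemLp f 2 𝕞
  integral_eq_zero : ∀ n : ℕ, ∫ θ, fourier ((n : ℤ) + 1) θ * f θ ∂𝕞 = 0

theorem isHardy_iff_isHardyFun (f : L2Torus) : IsHardy f ↔ IsHardyFun f := by
  refine ⟨fun h => ⟨Lp.memLp f, fun n => ?_⟩, fun h n hn => ?_⟩
  · simpa [fourierCoeff] using h (-((n : ℤ) + 1)) (by omega)
  · obtain ⟨k, hk⟩ : ∃ k : ℕ, -n = (k : ℤ) + 1 := ⟨(-n - 1).toNat, by omega⟩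
    simpa [fourierCoeff, hk] using h.integral_eq_zero k

theorem IsHardyFun.congr {f g : UnitTorus → ℂ} (hf : IsHardyFun f) (h : f =ᵐ[𝕞] g) :
    IsHardyFun g := by
  refine ⟨hf.memLp.ae_eq h, fun n => ?_⟩
  rw [← hf.integral_eq_zero n]
  exact integral_congr_ae (by filter_upwards [h] with θ hθ; rw [hθ])

theorem IsHardyFun.isInner_toLp {f : UnitTorus → ℂ} (hf : IsHardyFun f)
    (h1 : ∀ᵐ θ ∂𝕞, ‖f θ‖ = 1) : IsInner (hf.memLp.toLp f) := by
  have h := hf.memLp.coeFn_toLp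
  refine ⟨(isHardy_iff_isHardyFun _).2 (hf.congr h.symm), ?_⟩
  filter_upwards [h, h1] with θ a b
  rw [a, b]

theorem inner_toLp_toLp {f g : UnitTorus → ℂ} (hf : MemLp f 2 𝕞) (hg : MemLp g 2 𝕞) :
    inner ℂ (hf.toLp f) (hg.toLp g) = ∫ θ, g θ * conj (f θ) ∂𝕞 := by
  rw [L2.inner_def]
  refine integral_congr_ae ?_
  filter_upwards [hf.coeFn_toLp, hg.coeFn_toLp] with θ a b
  rw [a, b, RCLike.inner_apply]

/-- The functions in `H₂` and those in `z * H₂` annihilate each other under the bilinear pairing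
`∫ f * F`; the hypothesis `h` says that `F` belongs to `z * H₂`. -/
theorem IsHardyFun.integral_mul_eq_zero {f F : UnitTorus → ℂ} (hf : IsHardyFun f)
    (hF : MemLp F 2 𝕞) (h : ∀ n : ℕ, ∫ θ, fourier (n : ℤ) θ * F θ ∂𝕞 = 0) :
    ∫ θ, f θ * F θ ∂𝕞 = 0 := by
  have hc : MemLp (fun θ => conj (F θ)) 2 𝕞 := hF.star
  have hs := (hasSum_fourier_series_L2 (hf.memLp.toLp f)).mapL (innerSL ℂ (hc.toLp _))
  have key : innerSL ℂ (hc.toLp _) (hf.memLp.toLp f) = ∫ θ, f θ * F θ ∂𝕞 := by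
    rw [innerSL_apply_apply, inner_toLp_toLp]
    simp
  rw [← key]
  refine hs.unique ?_
  convert hasSum_zero with i
  rw [map_smul, innerSL_apply_apply, smul_eq_mul]
  rcases lt_or_ge i 0 with hi | hi
  · rw [((isHardy_iff_isHardyFun _).2 (hf.congr hf.memLp.coeFn_toLp.symm)) i hi, zero_mul]
  · lift i to ℕ using hi
    have : (fourierLp 2 (i : ℤ) : L2Torus) = (memLp_fourier i).toLp _ := rfl
    rw [this, inner_toLp_toLp]
    simp only [Complex.conj_conj]
    rw [h i, mul_zero]

theorem IsHardyFun.mul {φ f : UnitTorus → ℂ} (hφ : IsHardyFun φ) (hφ1 : ∀ᵐ θ ∂𝕞, ‖φ θ‖ = 1)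
    (hf : IsHardyFun f) : IsHardyFun (fun θ => φ θ * f θ) := by
  refine ⟨hf.memLp.of_le (hφ.memLp.1.mul hf.memLp.1) ?_, fun n => ?_⟩
  · filter_upwards [hφ1] with θ h
    rw [norm_mul, h, one_mul]
  · rw [← hf.integral_mul_eq_zero (hφ.memLp.fourier_mul ((n : ℤ) + 1)) fun m => ?_]
    · exact integral_congr_ae (.of_forall fun θ => by ring)
    · rw [← hφ.integral_eq_zero (m + n)]
      refine integral_congr_ae (.of_forall fun θ => ?_)
      simp only [← mul_assoc, ← fourier_add]
      push_cast
      rw [add_assoc]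

/-- Outer functions, understood as the cyclic vectors of the shift on `H₂`: the constant `1` lies in
the closed span of the `z ^ k * o`, `k ≥ 0`. This is stated in dual form: a function in `L₂` that
annihilates every `z ^ k * o` annihilates `1`. -/
def IsOuterFun (o : UnitTorus → ℂ) : Prop :=
  ∀ F : UnitTorus → ℂ, MemLp F 2 𝕞 → (∀ k : ℕ, ∫ θ, fourier (k : ℤ) θ * (o θ * F θ) ∂𝕞 = 0) →
    ∫ θ, F θ ∂𝕞 = 0

theorem IsOuterFun.integral_fourier_mul_eq_zero {o F : UnitTorus → ℂ} (ho : IsOuterFun o)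
    (hF : MemLp F 2 𝕞) (h : ∀ k : ℕ, ∫ θ, fourier (k : ℤ) θ * (o θ * F θ) ∂𝕞 = 0) (n : ℕ) :
    ∫ θ, fourier (n : ℤ) θ * F θ ∂𝕞 = 0 := by
  refine ho _ (hF.fourier_mul n) fun k => ?_
  rw [← h (k + n)]
  refine integral_congr_ae (.of_forall fun θ => ?_)
  push_cast
  simp only [fourier_add]
  ring

theorem IsOuterFun.ae_ne_zero {o : UnitTorus → ℂ} (ho : IsOuterFun o) (hm : MemLp o 2 𝕞) :
    ∀ᵐ θ ∂𝕞, o θ ≠ 0 := by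
  set s : Set UnitTorus := o ⁻¹' {0} with hs_def
  have hs : NullMeasurableSet s 𝕞 :=
    hm.1.aemeasurable.nullMeasurableSet_preimage (measurableSet_singleton 0)
  have hmeas : AEStronglyMeasurable (s.indicator fun _ => (1 : ℂ)) 𝕞 :=
    aestronglyMeasurable_const.indicator₀ hs
  have hF : MemLp (s.indicator fun _ => (1 : ℂ)) 2 𝕞 :=
    (memLp_const (1 : ℂ)).of_le hmeas (.of_forall fun θ => norm_indicator_le_norm_self _ θ)
  have h0 := ho _ hF fun k => by
    rw [integral_eq_zero_of_ae (.of_forall fun θ => ?_)]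
    by_cases hθ : o θ = 0 <;> simp [hs_def, hθ]
  rw [integral_indicator₀ hs, setIntegral_const, Complex.real_smul, mul_one,
    Complex.ofReal_eq_zero, measureReal_eq_zero_iff] at h0
  rw [ae_iff]
  simp only [not_not]
  exact h0

/-- Two functions in `H₂` of equal modulus, of which the denominator is outer, have an inner
quotient: approximating `1` by polynomial multiples of `o` approximates `p / o` by polynomial
multiples of `p`. -/
theorem IsOuterFun.isHardyFun_div {o p : UnitTorus → ℂ} (ho : IsOuterFun o) (hom : MemLp o 2 𝕞)
    (hp : IsHardyFun p) (h : ∀ᵐ θ ∂𝕞, ‖p θ‖ = ‖o θ‖) : IsHardyFun (fun θ => p θ / o θ) := by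
  have hv : MemLp (fun θ => p θ / o θ) 2 𝕞 := by
    refine (memLp_const (1 : ℂ)).of_le
      (hp.memLp.1.aemeasurable.div hom.1.aemeasurable).aestronglyMeasurable ?_
    filter_upwards [h] with θ h
    rw [norm_div, h, norm_one]
    exact div_self_le_one _
  refine ⟨hv, fun n => ho _ (hv.fourier_mul _) fun k => ?_⟩
  rw [← hp.integral_eq_zero (k + n)]
  refine integral_congr_ae ?_
  filter_upwards [ho.ae_ne_zero hom] with θ hθ
  push_cast
  simp only [fourier_add]
  field_simp

/-! ### Multiplication by powers of `z` in `L₂` -/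

theorem coeFn_zpowMul (n : ℤ) (f : L2Torus) :
    zpowMul n f =ᵐ[𝕞] fun θ => fourier n θ * f θ :=
  MemLp.coeFn_toLp _

theorem inner_zpowMul_right (n : ℤ) (f g : L2Torus) :
    inner ℂ f (zpowMul n g) = ∫ θ, fourier n θ * (g θ * conj (f θ)) ∂𝕞 := by
  rw [L2.inner_def]
  refine integral_congr_ae ?_
  filter_upwards [coeFn_zpowMul n g] with θ h
  rw [RCLike.inner_apply, h, mul_assoc]

theorem inner_zpowMul_left (n : ℤ) (f g : L2Torus) :
    inner ℂ (zpowMul n f) g = inner ℂ f (zpowMul (-n) g) := by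
  rw [inner_zpowMul_right, L2.inner_def]
  refine integral_congr_ae ?_
  filter_upwards [coeFn_zpowMul n f] with θ h
  rw [RCLike.inner_apply, h, map_mul, fourier_neg]
  ring

theorem zpowMul_zpowMul (m n : ℤ) (f : L2Torus) :
    zpowMul m (zpowMul n f) = zpowMul (m + n) f := by
  refine Lp.ext ?_
  filter_upwards [coeFn_zpowMul m (zpowMul n f), coeFn_zpowMul n f, coeFn_zpowMul (m + n) f]
    with θ h1 h2 h3
  rw [h1, h2, h3, fourier_add, mul_assoc]

theorem zpowMul_zero (f : L2Torus) : zpowMul 0 f = f := by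
  refine Lp.ext ?_
  filter_upwards [coeFn_zpowMul 0 f] with θ h
  rw [h, fourier_zero, one_mul]

theorem zpowMul_smul (n : ℤ) (c : ℂ) (f : L2Torus) : zpowMul n (c • f) = c • zpowMul n f := by
  refine Lp.ext ?_
  filter_upwards [coeFn_zpowMul n (c • f), Lp.coeFn_smul c f, Lp.coeFn_smul c (zpowMul n f),
    coeFn_zpowMul n f] with θ h1 h2 h3 h4
  rw [h1, h2, h3, Pi.smul_apply, Pi.smul_apply, h4, smul_eq_mul, smul_eq_mul]
  ring

theorem fourierCoeff_eq_inner (f : L2Torus) (n : ℤ) :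
    fourierCoeff f n = inner ℂ (fourierLp 2 n : L2Torus) f := by
  rw [← fourierBasis_repr, HilbertBasis.repr_apply_apply, coe_fourierBasis]

theorem zpowMul_fourierLp (m n : ℤ) :
    zpowMul m (fourierLp 2 n : L2Torus) = fourierLp 2 (m + n) := by
  refine Lp.ext ?_
  filter_upwards [coeFn_zpowMul m (fourierLp 2 n : L2Torus), coeFn_fourierLp (T := 2 * Real.pi) 2 n,
    coeFn_fourierLp (T := 2 * Real.pi) 2 (m + n)] with θ h1 h2 h3
  rw [h1, h2, h3, fourier_add]

theorem fourierCoeff_zpowMul (f : L2Torus) (m n : ℤ) :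
    fourierCoeff (zpowMul m f) n = fourierCoeff f (n - m) := by
  rw [fourierCoeff_eq_inner, ← neg_neg m, ← inner_zpowMul_left, zpowMul_fourierLp,
    ← fourierCoeff_eq_inner]
  congr 1
  ring

/-! ### Inner-outer factorization -/

theorem inner_eq_zero_of_mem_closure_span {E : Type*} [NormedAddCommGroup E]
    [InnerProductSpace ℂ E] {S : Set E} {v x : E} (h : ∀ s ∈ S, inner ℂ v s = 0)
    (hx : x ∈ (Submodule.span ℂ S).topologicalClosure) : inner ℂ v x = 0 := by
  have hle : (Submodule.span ℂ S).topologicalClosure ≤ LinearMap.ker (innerSL ℂ v).toLinearMap :=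
    Submodule.topologicalClosure_minimal _ (Submodule.span_le.2 h) (innerSL ℂ v).isClosed_ker
  exact hle hx

/-- The shift acts on the closed invariant subspace generated by `g` without being onto: all elements
of `span {z ^ k * g : k ≥ 1}` vanish to a higher order at the origin than `g` does. -/
theorem IsHardy.notMem_closure_span_shifts {g : L2Torus} (hg : IsHardy g) (h0 : g ≠ 0) :
    g ∉ (Submodule.span ℂ
      (Set.range fun k : ℕ => zpowMul ((k : ℤ) + 1) g)).topologicalClosure := by
  intro hmem
  have hz : ∀ n : ℕ, ∀ m : ℤ, m < n → fourierCoeff g m = 0 := by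
    intro n
    induction n with
    | zero => exact fun m hm => hg m (by simpa using hm)
    | succ n ih =>
      intro m hm
      rw [fourierCoeff_eq_inner]
      refine inner_eq_zero_of_mem_closure_span ?_ hmem
      rintro _ ⟨k, rfl⟩
      rw [← fourierCoeff_eq_inner, fourierCoeff_zpowMul]
      exact ih _ (by push_cast at hm; omega)
  refine h0 ((hasSum_fourier_series_L2 g).unique ?_)
  convert hasSum_zero with n
  rw [hz (n.toNat + 1) n (by push_cast; omega), zero_smul]

theorem integral_fourier (n : ℤ) : ∫ θ : UnitTorus, fourier n θ ∂𝕞 = if n = 0 then 1 else 0 := by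
  have h := congrFun (fourierCoeff_fourier (T := 2 * Real.pi) n) 0
  simpa only [fourierCoeff, neg_zero, fourier_zero, one_smul, Pi.single_apply, eq_comm] using h

/-- A unit vector orthogonal to its own shifts is unimodular, since `|φ| ^ 2` and `1` have the same
Fourier coefficients. -/
theorem ae_norm_eq_one_of_inner_zpowMul_eq_zero {φ : L2Torus} (h1 : ‖φ‖ = 1)
    (h : ∀ n : ℕ, inner ℂ φ (zpowMul ((n : ℤ) + 1) φ) = 0) : ∀ᵐ θ ∂𝕞, ‖φ θ‖ = 1 := by
  have hc : MemLp (fun θ => conj (φ θ)) 2 𝕞 := (Lp.memLp φ).star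
  have hint : Integrable (fun θ => φ θ * conj (φ θ)) 𝕞 := (Lp.memLp φ).integrable_mul hc
  have hfint : ∀ n : ℤ, Integrable (fun θ => fourier n θ * (φ θ * conj (φ θ))) 𝕞 := fun n =>
    hint.bdd_mul (fourier n).continuous.aestronglyMeasurable
      (.of_forall fun θ => (norm_fourier_apply n θ).le)
  have hcoef : ∀ n : ℤ, ∫ θ, fourier n θ * (φ θ * conj (φ θ)) ∂𝕞 = if n = 0 then 1 else 0 := by
    intro n
    rw [← inner_zpowMul_right]
    rcases lt_trichotomy n 0 with hn | rfl | hn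
    · obtain ⟨k, hk⟩ : ∃ k : ℕ, -n = (k : ℤ) + 1 := ⟨(-n - 1).toNat, by omega⟩
      rw [if_neg hn.ne, ← neg_neg n, ← inner_zpowMul_left, ← inner_conj_symm, hk, h, map_zero]
    · rw [zpowMul_zero, inner_self_eq_norm_sq_to_K, h1]
      simp
    · obtain ⟨k, hk⟩ : ∃ k : ℕ, n = (k : ℤ) + 1 := ⟨(n - 1).toNat, by omega⟩
      rw [if_neg hn.ne', hk, h]
  have hz := ae_eq_zero_of_integral_fourier_mul_eq_zero
    (F := fun θ => φ θ * conj (φ θ) - 1) (hint.sub (integrable_const 1)) fun n => by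
      simp only [mul_sub, mul_one]
      rw [integral_sub (hfint n) ((memLp_fourier n).integrable one_le_two), hcoef,
        integral_fourier, sub_self]
  filter_upwards [hz] with θ hθ
  rw [Pi.zero_apply, sub_eq_zero, Complex.mul_conj, Complex.normSq_eq_norm_sq] at hθ
  have : ‖φ θ‖ ^ 2 = 1 := by exact_mod_cast hθ
  exact (pow_eq_one_iff_of_nonneg (norm_nonneg _) two_ne_zero).1 this

/-- Inner-outer factorization, by Beurling's argument: the inner factor `φ` is the normalized
component of `g` orthogonal to `span {z ^ k * g : k ≥ 1}`, and the outer factor is `g * conj φ`. -/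
theorem IsHardy.exists_inner_mul_outer {g : L2Torus} (hg : IsHardy g) (h0 : g ≠ 0) :
    ∃ φ o : UnitTorus → ℂ, IsHardyFun φ ∧ (∀ᵐ θ ∂𝕞, ‖φ θ‖ = 1) ∧ IsHardyFun o ∧ IsOuterFun o ∧
      ∀ᵐ θ ∂𝕞, g θ = φ θ * o θ := by
  set N := (Submodule.span ℂ
    (Set.range fun k : ℕ => zpowMul ((k : ℤ) + 1) g)).topologicalClosure with hN
  set p : L2Torus := g - N.starProjection g with hp
  have hp0 : p ≠ 0 := by
    intro h
    refine hg.notMem_closure_span_shifts h0 ?_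
    rw [← hN, sub_eq_zero.1 h]
    exact N.starProjection_apply_mem g
  have hc0 : ((‖p‖ : ℂ)) ≠ 0 := by exact_mod_cast norm_ne_zero_iff.2 hp0
  set φ : L2Torus := (‖p‖ : ℂ)⁻¹ • p with hφ
  have hφ1 : ‖φ‖ = 1 := by
    rw [hφ, norm_smul, norm_inv, Complex.norm_real, norm_norm, inv_mul_cancel₀]
    exact_mod_cast hc0
  -- the next two facts determine everything: `φ` is orthogonal to `z ^ k * g` for `k ≥ 1`, and it
  -- belongs to the closed span of the `z ^ k * g`, `k ≥ 0`
  have hφN : ∀ k : ℕ, inner ℂ φ (zpowMul ((k : ℤ) + 1) g) = 0 := fun k => by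
    have : zpowMul ((k : ℤ) + 1) g ∈ N :=
      Submodule.le_topologicalClosure _ (Submodule.subset_span ⟨k, rfl⟩)
    rw [hφ, inner_smul_left,
      (Submodule.mem_orthogonal' _ _).1 (N.sub_starProjection_mem_orthogonal g) _ this, mul_zero]
  have hφmem : ∀ v : L2Torus, (∀ k : ℕ, inner ℂ v (zpowMul (k : ℤ) g) = 0) →
      inner ℂ v φ = 0 := by
    intro v hv
    have hv0 : inner ℂ v g = 0 := by simpa [zpowMul_zero] using hv 0
    have hv1 : inner ℂ v (N.starProjection g) = 0 := by
      refine inner_eq_zero_of_mem_closure_span ?_ (N.starProjection_apply_mem g)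
      rintro _ ⟨k, rfl⟩
      exact_mod_cast hv (k + 1)
    rw [hφ, inner_smul_right, hp, inner_sub_right, hv0, hv1, sub_self, mul_zero]
  have hφn : ∀ᵐ θ ∂𝕞, ‖φ θ‖ = 1 := by
    refine ae_norm_eq_one_of_inner_zpowMul_eq_zero hφ1 fun n => ?_
    rw [← neg_neg ((n : ℤ) + 1), ← inner_zpowMul_left]
    refine hφmem _ fun k => ?_
    rw [inner_zpowMul_left, zpowMul_zpowMul, ← hφN (n + k)]
    congr 2
    push_cast
    ring
  have hφH : IsHardyFun φ := by
    refine (isHardy_iff_isHardyFun φ).1 fun n hn => ?_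
    rw [fourierCoeff_eq_inner]
    refine hφmem _ fun k => ?_
    rw [← fourierCoeff_eq_inner, fourierCoeff_zpowMul]
    exact hg _ (by omega)
  have ho : MemLp (fun θ => g θ * conj (φ θ)) 2 𝕞 := by
    refine (Lp.memLp g).of_le ((Lp.memLp g).1.mul (Lp.memLp φ).star.1) ?_
    filter_upwards [hφn] with θ h
    rw [norm_mul, RCLike.norm_conj, h, mul_one]
  refine ⟨φ, fun θ => g θ * conj (φ θ), hφH, hφn, ⟨ho, fun n => ?_⟩, fun F hF h => ?_, ?_⟩
  · rw [← inner_zpowMul_right, hφN]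
  · -- `∫ F` is the inner product of `φ` with `φ * conj F`, which is orthogonal to all `z ^ k * g`
    have hv : MemLp (fun θ => φ θ * conj (F θ)) 2 𝕞 := by
      refine hF.of_le ((Lp.memLp φ).1.mul hF.star.1) ?_
      filter_upwards [hφn] with θ h
      rw [norm_mul, RCLike.norm_conj, h, one_mul]
    have hi := hφmem (hv.toLp _) fun k => by
      rw [inner_zpowMul_right, ← h k]
      refine integral_congr_ae ?_
      filter_upwards [hv.coeFn_toLp] with θ e
      rw [e, map_mul, Complex.conj_conj]
      ring
    rw [← hi, L2.inner_def]
    refine integral_congr_ae ?_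
    filter_upwards [hv.coeFn_toLp, hφn] with θ e e1
    rw [RCLike.inner_apply, e, map_mul, Complex.conj_conj, ← mul_assoc, Complex.mul_conj,
      Complex.normSq_eq_norm_sq, e1]
    simp
  · filter_upwards [hφn] with θ e
    rw [mul_comm (g θ), ← mul_assoc, Complex.mul_conj, Complex.normSq_eq_norm_sq, e]
    simp

/-- A nonzero function in `H₂` is nonzero almost everywhere. -/
theorem IsHardy.ae_ne_zero {g : L2Torus} (hg : IsHardy g) (h0 : g ≠ 0) : ∀ᵐ θ ∂𝕞, g θ ≠ 0 := by
  obtain ⟨φ, o, -, hφ1, ho, hoo, e⟩ := hg.exists_inner_mul_outer h0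
  filter_upwards [hφ1, hoo.ae_ne_zero ho.memLp, e] with θ h1 h2 h3
  rw [h3]
  exact mul_ne_zero (norm_ne_zero_iff.1 (by rw [h1]; exact one_ne_zero)) h2

/-! ### Shift invariance and density of the future span -/

theorem topologicalClosure_span_eq_top_iff {E : Type*} [NormedAddCommGroup E]
    [InnerProductSpace ℂ E] [CompleteSpace E] {S : Set E} :
    (Submodule.span ℂ S).topologicalClosure = ⊤ ↔
      ∀ f : E, (∀ s ∈ S, inner ℂ f s = 0) → f = 0 := by
  rw [Submodule.topologicalClosure_eq_top_iff, Submodule.eq_bot_iff]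
  refine forall_congr' fun f => imp_congr_left ?_
  rw [Submodule.mem_orthogonal']
  exact ⟨fun h s hs => h s (Submodule.subset_span hs), fun h u hu =>
    inner_eq_zero_of_mem_closure_span h (Submodule.le_topologicalClosure _ hu)⟩

/-- The shifts `z ^ (-k) * g` and `z ^ (-k) * h` with `k > t`. -/
def futureShifts (g h : L2Torus) (t : ℤ) : Set L2Torus :=
  {v | ∃ k : ℤ, t < k ∧ (v = zpowMul (-k) g ∨ v = zpowMul (-k) h)}

theorem closedSpanNegShifts_sup_eq_top_iff (g h : L2Torus) :
    (closedSpanNegShifts g ⊔ closedSpanNegShifts h).topologicalClosure = ⊤ ↔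
      ∀ f : L2Torus, (∀ k : ℕ, inner ℂ f (zpowMul (-(k : ℤ)) g) = 0) →
        (∀ k : ℕ, inner ℂ f (zpowMul (-(k : ℤ)) h) = 0) → f = 0 := by
  rw [Submodule.topologicalClosure_eq_top_iff, Submodule.eq_bot_iff]
  refine forall_congr' fun f => ?_
  rw [← and_imp, ← Submodule.inf_orthogonal, Submodule.mem_inf, Submodule.mem_orthogonal',
    Submodule.mem_orthogonal']
  have key : ∀ g : L2Torus, (∀ u ∈ closedSpanNegShifts g, inner ℂ f u = 0) ↔
      ∀ k : ℕ, inner ℂ f (zpowMul (-(k : ℤ)) g) = 0 := fun g => by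
    refine ⟨fun H k => H _ (Submodule.le_topologicalClosure _ (Submodule.subset_span ⟨k, rfl⟩)),
      fun H u hu => inner_eq_zero_of_mem_closure_span ?_ hu⟩
    rintro _ ⟨k, rfl⟩
    exact H k
  rw [key, key]

theorem inner_zpowMul_neg_eq_zero_iff (f g : L2Torus) (k : ℤ) :
    inner ℂ f (zpowMul (-k) g) = 0 ↔ ∫ θ, fourier k θ * (f θ * conj (g θ)) ∂𝕞 = 0 := by
  rw [← inner_zpowMul_left, ← inner_conj_symm, inner_zpowMul_right, map_eq_zero]

theorem IsHardy.ae_eq_zero_of_forall_inner_zpowMul_eq_zero {f g : L2Torus} (hg : IsHardy g)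
    (h0 : g ≠ 0) (h : ∀ k : ℤ, inner ℂ f (zpowMul k g) = 0) : f = 0 := by
  have hz := ae_eq_zero_of_integral_fourier_mul_eq_zero
    (F := fun θ => g θ * conj (f θ)) ((Lp.memLp g).integrable_mul (Lp.memLp f).star) fun k => by
      rw [← inner_zpowMul_right, h]
  refine (Lp.eq_zero_iff_ae_eq_zero).2 ?_
  filter_upwards [hz, hg.ae_ne_zero h0] with θ h1 h2
  simpa [h2] using h1

/-- If the future determines the present at every time, then the closed spans of `futureShifts g h t`
all coincide, so a vector orthogonal to one of them is orthogonal to all `z ^ k * g`, `k ∈ ℤ`, and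
vanishes. Conversely, density for one `t` is density for all, by translation. -/
theorem forall_mem_closure_futureShifts_iff {g h : L2Torus} (hg : IsHardy g) (hg0 : g ≠ 0) :
    (∀ t : ℤ, zpowMul (-t) g ∈ (Submodule.span ℂ (futureShifts g h t)).topologicalClosure ∧
        zpowMul (-t) h ∈ (Submodule.span ℂ (futureShifts g h t)).topologicalClosure) ↔
      (closedSpanNegShifts g ⊔ closedSpanNegShifts h).topologicalClosure = ⊤ := by
  rw [closedSpanNegShifts_sup_eq_top_iff]
  constructor
  · intro H f hf1 hf2
    have hall : ∀ n : ℕ, ∀ k : ℤ, -(n : ℤ) ≤ k →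
        inner ℂ f (zpowMul (-k) g) = 0 ∧ inner ℂ f (zpowMul (-k) h) = 0 := by
      intro n
      induction n with
      | zero =>
        intro k hk
        lift k to ℕ using by simpa using hk
        exact ⟨hf1 k, hf2 k⟩
      | succ n ih =>
        intro k hk
        have hS : ∀ s ∈ futureShifts g h k, inner ℂ f s = 0 := by
          rintro _ ⟨j, hj, rfl | rfl⟩
          · exact (ih j (by push_cast at hk; omega)).1
          · exact (ih j (by push_cast at hk; omega)).2
        exact ⟨inner_eq_zero_of_mem_closure_span hS (H k).1,
          inner_eq_zero_of_mem_closure_span hS (H k).2⟩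
    refine hg.ae_eq_zero_of_forall_inner_zpowMul_eq_zero hg0 fun k => ?_
    rw [← neg_neg k]
    exact (hall k.natAbs (-k) (by omega)).1
  · intro H t
    have htop : (Submodule.span ℂ (futureShifts g h t)).topologicalClosure = ⊤ := by
      rw [topologicalClosure_span_eq_top_iff]
      intro f hf
      have h0 : zpowMul (t + 1) f = 0 := by
        refine H _ (fun k => ?_) fun k => ?_
        · rw [inner_zpowMul_left, zpowMul_zpowMul]
          exact hf _ ⟨t + 1 + k, by omega, .inl (by congr 1; ring)⟩
        · rw [inner_zpowMul_left, zpowMul_zpowMul]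
          exact hf _ ⟨t + 1 + k, by omega, .inr (by congr 1; ring)⟩
      have h1 := inner_zpowMul_left (t + 1) f (zpowMul (t + 1) f)
      rw [zpowMul_zpowMul, neg_add_cancel, zpowMul_zero, h0, inner_zero_left] at h1
      exact inner_self_eq_zero.1 h1.symm
    rw [htop]
    exact ⟨Submodule.mem_top, Submodule.mem_top⟩

/-! ### The spectral isometry of white noise -/

section WhiteNoise

variable {Ω : Type*} [MeasurableSpace Ω] {P : Measure Ω} {w : ℤ → Lp ℂ 2 P}

theorem IsWhiteNoise.orthonormal (hw : IsWhiteNoise P w) : Orthonormal ℂ fun n : ℤ => w (-n) := by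
  rw [orthonormal_iff_ite]
  intro i j
  rw [L2.inner_def]
  simp only [RCLike.inner_apply]
  rw [hw.covariance]
  simp [eq_comm]

/-- The spectral isometry `z ^ n ↦ w (-n)` from `L₂` of the circle to the random variables. -/
noncomputable def IsWhiteNoise.isometry (hw : IsWhiteNoise P w) : L2Torus →ₗᵢ[ℂ] Lp ℂ 2 P :=
  hw.orthonormal.orthogonalFamily.linearIsometry.comp
    (fourierBasis (T := 2 * Real.pi)).repr.toLinearIsometry

theorem IsWhiteNoise.isometry_fourierLp (hw : IsWhiteNoise P w) (n : ℤ) :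
    hw.isometry (fourierLp 2 n) = w (-n) := by
  have hrepr : (fourierBasis (T := 2 * Real.pi)).repr (fourierLp 2 n) = lp.single 2 n (1 : ℂ) := by
    have h := (fourierBasis (T := 2 * Real.pi)).repr_self n
    rwa [coe_fourierBasis] at h
  have hsingle := hw.orthonormal.orthogonalFamily.linearIsometry_apply_single (i := n) (1 : ℂ)
  rw [LinearIsometry.toSpanSingleton_apply, one_smul] at hsingle
  exact (congrArg _ hrepr).trans hsingle

theorem IsHardy.hasSum_nat {f : L2Torus} (hf : IsHardy f) :
    HasSum (fun l : ℕ => fourierCoeff f (l : ℤ) • (fourierLp 2 (l : ℤ) : L2Torus)) f := by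
  have hsupp : ∀ n ∉ Set.range ((↑) : ℕ → ℤ),
      fourierCoeff f n • (fourierLp 2 n : L2Torus) = 0 := fun n hn => by
    have hneg : n < 0 := not_le.1 fun hle => hn ⟨n.toNat, Int.toNat_of_nonneg hle⟩
    rw [hf n hneg, zero_smul]
  have h := hasSum_fourier_series_L2 f
  rw [← Function.Injective.hasSum_iff (Nat.cast_injective (R := ℤ)) hsupp] at h
  exact h

/-- Multiplication by `z ^ n` as a linear isometry. -/
noncomputable def zpowMulₗᵢ (n : ℤ) : L2Torus →ₗᵢ[ℂ] L2Torus where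
  toFun := zpowMul n
  map_add' f g := by
    refine Lp.ext ?_
    filter_upwards [coeFn_zpowMul n (f + g), Lp.coeFn_add f g,
      Lp.coeFn_add (zpowMul n f) (zpowMul n g), coeFn_zpowMul n f, coeFn_zpowMul n g]
      with θ h1 h2 h3 h4 h5
    rw [h1, h2, h3, Pi.add_apply, Pi.add_apply, h4, h5, mul_add]
  map_smul' c f := zpowMul_smul n c f
  norm_map' f := by
    have h := inner_zpowMul_left n f (zpowMul n f)
    rw [zpowMul_zpowMul, neg_add_cancel, zpowMul_zero, inner_self_eq_norm_sq_to_K,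
      inner_self_eq_norm_sq_to_K] at h
    exact (sq_eq_sq₀ (norm_nonneg _) (norm_nonneg _)).1 (by exact_mod_cast h)

theorem IsGeneratedBy.eq_isometry (hw : IsWhiteNoise P w) {f : L2Torus} (hf : IsHardy f)
    {x : ℤ → Lp ℂ 2 P} (hx : IsGeneratedBy f w x) (k : ℤ) :
    x k = hw.isometry (zpowMul (-k) f) := by
  have h := hf.hasSum_nat.mapL
    (hw.isometry.comp (zpowMulₗᵢ (-k))).toContinuousLinearMap
  refine (hx k).unique ?_
  change HasSum _ (hw.isometry (zpowMul (-k) f)) at h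
  convert h using 2 with l
  have e : hw.isometry (zpowMul (-k) (fourierLp 2 (l : ℤ))) = w (k - l) := by
    rw [zpowMul_fourierLp, hw.isometry_fourierLp]
    congr 1
    ring
  rw [map_smul, ← e]
  rfl

theorem isBackwardDeterministic_iff (ξ : ℤ → Fin 2 → Lp ℂ 2 P) :
    IsBackwardDeterministic ξ ↔ ∀ t i, ξ t i ∈ futureSpan ξ t := by
  have key : ∀ t i j, backwardErrorVariance ξ t i j =
      inner ℂ (backwardError ξ t j) (backwardError ξ t i) := fun t i j => by
    rw [L2.inner_def]
    simp only [RCLike.inner_apply]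
    rfl
  have hmem : ∀ t i, backwardError ξ t i = 0 ↔ ξ t i ∈ futureSpan ξ t := fun t i => by
    rw [backwardError, sub_eq_zero, eq_comm, Submodule.starProjection_eq_self_iff]
  constructor
  · intro H t i
    rw [← hmem, ← inner_self_eq_zero (𝕜 := ℂ), ← key, H t]
    rfl
  · intro H t
    ext i j
    rw [key, (hmem t i).2 (H t i), inner_zero_right]
    rfl

theorem LinearIsometry.map_mem_closure_span_image_iff {E F : Type*} [NormedAddCommGroup E]
    [InnerProductSpace ℂ E] [CompleteSpace E] [NormedAddCommGroup F] [InnerProductSpace ℂ F]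
    (U : E →ₗᵢ[ℂ] F) (S : Set E) (v : E) :
    U v ∈ (Submodule.span ℂ (U '' S)).topologicalClosure ↔
      v ∈ (Submodule.span ℂ S).topologicalClosure := by
  have h : ((Submodule.span ℂ (U '' S)).topologicalClosure : Set F) =
      U '' ((Submodule.span ℂ S).topologicalClosure : Set E) := by
    rw [Submodule.topologicalClosure_coe, Submodule.topologicalClosure_coe,
      ← U.isometry.isClosedEmbedding.closure_image_eq]
    congr 1
    rw [← LinearIsometry.coe_toLinearMap, ← Submodule.map_span]
    rfl
  rw [← SetLike.mem_coe, h, U.injective.mem_set_image, SetLike.mem_coe]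

/-- The spectral isometry carries `z ^ (-k) * g` and `z ^ (-k) * h` to `x k` and `y k`, and thereby
turns backward determinism into a statement about `L₂` of the circle. -/
theorem IsWhiteNoise.isBackwardDeterministic_iff (hw : IsWhiteNoise P w) {g h : L2Torus}
    (hg : IsHardy g) (hh : IsHardy h) {x y : ℤ → Lp ℂ 2 P} (hx : IsGeneratedBy g w x)
    (hy : IsGeneratedBy h w y) :
    IsBackwardDeterministic (fun k => ![x k, y k]) ↔
      ∀ t : ℤ, zpowMul (-t) g ∈ (Submodule.span ℂ (futureShifts g h t)).topologicalClosure ∧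
        zpowMul (-t) h ∈ (Submodule.span ℂ (futureShifts g h t)).topologicalClosure := by
  rw [_root_.isBackwardDeterministic_iff]
  refine forall_congr' fun t => ?_
  have himg : {v | ∃ k : ℤ, t < k ∧ ∃ i : Fin 2, v = ![x k, y k] i} =
      hw.isometry '' futureShifts g h t := by
    ext v
    constructor
    · rintro ⟨k, hk, i, rfl⟩
      fin_cases i
      · exact ⟨_, ⟨k, hk, .inl rfl⟩, (hx.eq_isometry hw hg k).symm⟩
      · exact ⟨_, ⟨k, hk, .inr rfl⟩, (hy.eq_isometry hw hh k).symm⟩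
    · rintro ⟨_, ⟨k, hk, rfl | rfl⟩, rfl⟩
      · exact ⟨k, hk, 0, (hx.eq_isometry hw hg k).symm⟩
      · exact ⟨k, hk, 1, (hy.eq_isometry hw hh k).symm⟩
  rw [futureSpan, himg, Fin.forall_fin_two]
  simp only [Matrix.cons_val_zero, Matrix.cons_val_one]
  rw [hx.eq_isometry hw hg, hy.eq_isometry hw hh, LinearIsometry.map_mem_closure_span_image_iff,
    LinearIsometry.map_mem_closure_span_image_iff]

end WhiteNoise

/-! ### Quotients of inner functions -/

/-- If `f` is orthogonal to all `z ^ (-k) * g`, `k ≥ 0`, and `g = φ * o` is the inner-outer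
factorization, then `f * conj g / o`, which has the modulus of `f`, belongs to `z * H₂`; here `ψ * p`
is its inner-outer factorization. -/
theorem exists_factorization_of_orthogonal {f g : L2Torus} (hf0 : f ≠ 0) (hg : IsHardy g)
    (hg0 : g ≠ 0) (h : ∀ k : ℕ, inner ℂ f (zpowMul (-(k : ℤ)) g) = 0) :
    ∃ φ o ψ p : UnitTorus → ℂ, (IsHardyFun φ ∧ ∀ᵐ θ ∂𝕞, ‖φ θ‖ = 1) ∧ (∀ᵐ θ ∂𝕞, o θ ≠ 0) ∧
      (IsHardyFun ψ ∧ ∀ᵐ θ ∂𝕞, ‖ψ θ‖ = 1) ∧ (IsHardyFun p ∧ IsOuterFun p) ∧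
      (∀ᵐ θ ∂𝕞, g θ = φ θ * o θ) ∧ (∀ᵐ θ ∂𝕞, f θ * conj (g θ) = ψ θ * p θ * o θ) ∧
      ∀ᵐ θ ∂𝕞, ‖p θ‖ = ‖f θ‖ := by
  obtain ⟨φ, o, hφ, hφ1, ho, hoo, hgφ⟩ := hg.exists_inner_mul_outer hg0
  have ho0 := hoo.ae_ne_zero ho.memLp
  have hnorm : ∀ᵐ θ ∂𝕞, ‖f θ * conj (g θ) / o θ‖ = ‖f θ‖ := by
    filter_upwards [hφ1, ho0, hgφ] with θ h1 h2 h3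
    rw [norm_div, norm_mul, RCLike.norm_conj, h3, norm_mul, h1, one_mul,
      mul_div_cancel_right₀ _ (norm_ne_zero_iff.2 h2)]
  have hF : MemLp (fun θ => f θ * conj (g θ) / o θ) 2 𝕞 := by
    refine (Lp.memLp f).of_le ?_ (hnorm.mono fun θ e => e.le)
    exact (((Lp.memLp f).1.mul (Lp.memLp g).star.1).aemeasurable.div
      ho.memLp.1.aemeasurable).aestronglyMeasurable
  have hFz := hoo.integral_fourier_mul_eq_zero hF fun k => by
    rw [← (inner_zpowMul_neg_eq_zero_iff f g k).1 (h k)]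
    refine integral_congr_ae ?_
    filter_upwards [ho0] with θ h2
    rw [mul_div_cancel₀ _ h2]
  have hFH : IsHardyFun (fun θ => f θ * conj (g θ) / o θ) :=
    ⟨hF, fun n => by exact_mod_cast hFz (n + 1)⟩
  have hGe := hF.coeFn_toLp
  obtain ⟨ψ, p, hψ, hψ1, hp, hpo, hG⟩ :=
    ((isHardy_iff_isHardyFun _).2 (hFH.congr hGe.symm)).exists_inner_mul_outer fun hG0 => by
      refine hf0 ((Lp.eq_zero_iff_ae_eq_zero).2 ?_)
      filter_upwards [hnorm, (Lp.eq_zero_iff_ae_eq_zero).1 hG0, hGe] with θ h1 h2 h3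
      rw [h2, Pi.zero_apply] at h3
      rw [← h3, norm_zero] at h1
      exact norm_eq_zero.1 h1.symm
  refine ⟨φ, o, ψ, p, ⟨hφ, hφ1⟩, ho0, ⟨hψ, hψ1⟩, ⟨hp, hpo⟩, hgφ, ?_, ?_⟩
  · filter_upwards [ho0, hG, hGe] with θ h1 h2 h3
    rw [← h2, h3, div_mul_cancel₀ _ h1]
  · filter_upwards [hG, hGe, hnorm, hψ1] with θ h1 h2 h3 h4
    rw [← h3, ← h2, h1, norm_mul, h4, one_mul]

/-- With `g = φ₁ * o₁`, `h = φ₂ * o₂`, `f * conj g = ψ₁ * p₁ * o₁` and `f * conj h = ψ₂ * p₂ * o₂`,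
the quotient is `φ₁ * ψ₂ * (p₂ / p₁) / (φ₂ * ψ₁)`, and `p₂ / p₁` is inner because `p₁` and `p₂` have
the modulus of `f` and `p₁` is outer. -/
theorem mem_innerQuotients_of_orthogonal {f g h : L2Torus} (hf0 : f ≠ 0) (hg : IsHardy g)
    (hg0 : g ≠ 0) (hh : IsHardy h) (hh0 : h ≠ 0)
    (hfg : ∀ k : ℕ, inner ℂ f (zpowMul (-(k : ℤ)) g) = 0)
    (hfh : ∀ k : ℕ, inner ℂ f (zpowMul (-(k : ℤ)) h) = 0) :
    (fun θ : UnitTorus => g θ * conj (h θ) / (conj (g θ) * h θ)) ∈ innerQuotients := by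
  obtain ⟨φ₁, o₁, ψ₁, p₁, ⟨hφ₁, nφ₁⟩, ho₁, ⟨hψ₁, nψ₁⟩, ⟨hp₁, hpo₁⟩, eg, efg, np₁⟩ :=
    exists_factorization_of_orthogonal hf0 hg hg0 hfg
  obtain ⟨φ₂, o₂, ψ₂, p₂, ⟨hφ₂, nφ₂⟩, ho₂, ⟨hψ₂, nψ₂⟩, ⟨hp₂, -⟩, eh, efh, np₂⟩ :=
    exists_factorization_of_orthogonal hf0 hh hh0 hfh
  have hp₁0 := hpo₁.ae_ne_zero hp₁.memLp
  have hv := hpo₁.isHardyFun_div hp₁.memLp hp₂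
    (by filter_upwards [np₁, np₂] with θ h1 h2; rw [h1, h2])
  have nv : ∀ᵐ θ ∂𝕞, ‖p₂ θ / p₁ θ‖ = 1 := by
    filter_upwards [np₁, np₂, hp₁0] with θ h1 h2 h3
    rw [norm_div, h2, ← h1, div_self (norm_ne_zero_iff.2 h3)]
  have hα := hφ₁.mul nφ₁ (hψ₂.mul nψ₂ hv)
  have nα : ∀ᵐ θ ∂𝕞, ‖φ₁ θ * (ψ₂ θ * (p₂ θ / p₁ θ))‖ = 1 := by
    filter_upwards [nφ₁, nψ₂, nv] with θ h1 h2 h3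
    rw [norm_mul, norm_mul, h1, h2, h3, one_mul, one_mul]
  have hβ := hφ₂.mul nφ₂ hψ₁
  have nβ : ∀ᵐ θ ∂𝕞, ‖φ₂ θ * ψ₁ θ‖ = 1 := by
    filter_upwards [nφ₂, nψ₁] with θ h1 h2
    rw [norm_mul, h1, h2, one_mul]
  refine ⟨_, _, hα.isInner_toLp nα, hβ.isInner_toLp nβ, ?_⟩
  filter_upwards [hα.memLp.coeFn_toLp, hβ.memLp.coeFn_toLp, eg, eh, efg, efh, ho₁, ho₂, hp₁0, np₁,
    nβ, hg.ae_ne_zero hg0] with θ hα hβ eg eh efg efh ho₁ ho₂ hp₁0 np₁ nβ hg0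
  rw [hα, hβ]
  have hf : f θ ≠ 0 := norm_ne_zero_iff.1 (np₁ ▸ norm_ne_zero_iff.2 hp₁0)
  have hβ0 : φ₂ θ * ψ₁ θ ≠ 0 := norm_ne_zero_iff.1 (by rw [nβ]; exact one_ne_zero)
  have hφ₂0 := left_ne_zero_of_mul hβ0
  have hψ₁0 := right_ne_zero_of_mul hβ0
  have hgc : conj (g θ) = ψ₁ θ * p₁ θ * o₁ θ / f θ := by rw [← efg]; field_simp
  have hhc : conj (h θ) = ψ₂ θ * p₂ θ * o₂ θ / f θ := by rw [← efh]; field_simp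
  rw [hgc, hhc, eg, eh]
  field_simp

/-- If the quotient is `α / β`, the function `f = z * β * g / conj g` satisfies
`f * conj g = z * β * g` and `f * conj h = z * α * h`, both in `z * H₁`. -/
theorem exists_orthogonal_of_mem_innerQuotients {g h : L2Torus} (hg : IsHardy g)
    (hg0 : g ≠ 0) (hh : IsHardy h) (hh0 : h ≠ 0)
    (hq : (fun θ : UnitTorus => g θ * conj (h θ) / (conj (g θ) * h θ)) ∈ innerQuotients) :
    ∃ f : L2Torus, f ≠ 0 ∧ (∀ k : ℕ, inner ℂ f (zpowMul (-(k : ℤ)) g) = 0) ∧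
      ∀ k : ℕ, inner ℂ f (zpowMul (-(k : ℤ)) h) = 0 := by
  obtain ⟨α, β, ⟨hα, nα⟩, ⟨hβ, nβ⟩, e⟩ := hq
  have hg' := hg.ae_ne_zero hg0
  have hh' := hh.ae_ne_zero hh0
  have nf : ∀ᵐ θ ∂𝕞, ‖fourier 1 θ * (β θ * (g θ / conj (g θ)))‖ = 1 := by
    filter_upwards [nβ, hg'] with θ h1 h2
    rw [norm_mul, norm_fourier_apply, norm_mul, h1, norm_div, RCLike.norm_conj,
      div_self (norm_ne_zero_iff.2 h2), one_mul, one_mul]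
  have hf : MemLp (fun θ => fourier 1 θ * (β θ * (g θ / conj (g θ)))) 2 𝕞 := by
    refine (memLp_const (1 : ℂ)).of_le ?_ (nf.mono fun θ e => by rw [e, norm_one])
    exact (fourier 1).continuous.aestronglyMeasurable.mul ((Lp.memLp β).1.mul
      ((Lp.memLp g).1.aemeasurable.div (Lp.memLp g).star.1.aemeasurable).aestronglyMeasurable)
  have hfe := hf.coeFn_toLp
  have hzero : ∀ (γ u : L2Torus), IsHardy γ → (∀ᵐ θ ∂𝕞, ‖γ θ‖ = 1) → IsHardy u →
      (∀ᵐ θ ∂𝕞, β θ * (g θ / conj (g θ)) * conj (u θ) = γ θ * u θ) →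
      ∀ k : ℕ, inner ℂ (hf.toLp _) (zpowMul (-(k : ℤ)) u) = 0 := by
    intro γ u hγ nγ hu eu k
    rw [inner_zpowMul_neg_eq_zero_iff,
      ← (((isHardy_iff_isHardyFun γ).1 hγ).mul nγ ((isHardy_iff_isHardyFun u).1 hu)).integral_eq_zero
        k]
    refine integral_congr_ae ?_
    filter_upwards [hfe, eu] with θ h1 h2
    rw [h1, ← h2, fourier_add]
    ring
  refine ⟨hf.toLp _, fun h0 => ?_, hzero β g hβ nβ hg ?_, hzero α h hα nα hh ?_⟩
  · have hF : ∀ᵐ θ ∂𝕞, False := by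
      filter_upwards [hfe, nf, (Lp.eq_zero_iff_ae_eq_zero).1 h0] with θ h1 h2 h3
      rw [← h1, h3, Pi.zero_apply, norm_zero] at h2
      exact zero_ne_one h2
    exact hF.exists.elim fun _ h => h
  · filter_upwards [hg'] with θ h1
    have : conj (g θ) ≠ 0 := (map_ne_zero _).2 h1
    field_simp
  · filter_upwards [hg', hh', nβ, e] with θ h1 h2 h3 h4
    have h1c : conj (g θ) ≠ 0 := (map_ne_zero _).2 h1
    have hβ0 : β θ ≠ 0 := norm_ne_zero_iff.1 (by rw [h3]; exact one_ne_zero)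
    rw [div_eq_div_iff (mul_ne_zero h1c h2) hβ0] at h4
    field_simp
    linear_combination h4

theorem theorem5 {Ω : Type*} [MeasurableSpace Ω] (P : Measure Ω) [IsProbabilityMeasure P]
    (w x y : ℤ → Lp ℂ 2 P) (hw : IsWhiteNoise P w)
    (g h : L2Torus) (hg : IsHardy g) (hh : IsHardy h) (hg0 : g ≠ 0) (hh0 : h ≠ 0)
    (hx : IsGeneratedBy g w x) (hy : IsGeneratedBy h w y) :
    List.TFAE [
      IsBackwardDeterministic (fun k => ![x k, y k]),
      (closedSpanNegShifts g ⊔ closedSpanNegShifts h).topologicalClosure = ⊤,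
      (fun θ : UnitTorus => g θ * conj (h θ) / (conj (g θ) * h θ)) ∉ innerQuotients] := by
  tfae_have 1 ↔ 2 :=
    (hw.isBackwardDeterministic_iff hg hh hx hy).trans (forall_mem_closure_futureShifts_iff hg hg0)
  tfae_have 2 → 3 := fun H hq => by
    obtain ⟨f, hf0, hfg, hfh⟩ := exists_orthogonal_of_mem_innerQuotients hg hg0 hh hh0 hq
    exact hf0 ((closedSpanNegShifts_sup_eq_top_iff g h).1 H f hfg hfh)
  tfae_have 3 → 2 := fun hq => by
    rw [closedSpanNegShifts_sup_eq_top_iff]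
    intro f hfg hfh
    by_contra hf0
    exact hq (mem_innerQuotients_of_orthogonal hf0 hg hg0 hh hh0 hfg hfh)
  tfae_finish
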